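/- Let $\mathcal G$ be a weighted digraph on nodes $v_1,\dots,v_n$ with adjacency weights $a_{ij}\ge 0$, $a_{ii}=0$, where $e_{ij}=(v_i,v_j)$ is an edge if and only if $a_{ji}>0$. Let $\Delta>0$, let $q^s(z)=\lfloor z/\Delta+\tfrac12\rfloor\,\Delta$ be the symmetric quantizer, and consider the system $\dot x=X(x)$ on $\mathbb R^n$ with $$X_i(x)=\sum_{j=1}^n a_{ij}\,q^s(x_j-x_i),\qquad i=1,\dots,n.$$ A Filippov solution on $[0,\infty)$ is a function $x:[0,\infty)\to\mathbb R^n$ that is absolutely continuous on every $[0,T]$ and satisfies $\dot x(t)\in\mathcal F[X](x(t))$ for almost every $t\ge 0$, where $$\mathcal F[X](x)=\bigcap_{\delta>0}\ \bigcap_{\mu(S)=0}\overline{\mathrm{co}}\,\{X(B(x,\delta)\setminus S)\}$$ and $\mu$ is Lebesgue measure. Let $$\mathcal H_1=\{x\in\mathbb R^n : -\tfrac12\Delta\le x_i-x_j\le\tfrac12\Delta \text{ for every edge } e_{ij}\}.$$ Suppose that one of the following holds: 1. $\mathcal G$ is undirected, i.e. $a_{ij}=a_{ji}$ for all $i,j$;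 2. $\mathcal G$ is a directed ring, i.e. every node has exactly one outgoing edge and exactly one incoming edge; or $\mathcal G$ is a directed spanning tree, i.e. there is a root with no incoming edge, every other node has exactly one incoming edge, and there is a directed path from the root to every node. Then every Filippov solution $x$ on $[0,\infty)$ converges to $\mathcal H_1$, i.e. $\operatorname{dist}(x(t),\mathcal H_1)\to 0$ as $t\to\infty$. -/

import Mathlib

noncomputable section

namespace QuantizedConsensus

/-- The Filippov set-valued map of a vector field `X`:
the intersection, over all radii `δ > 0` and all Lebesgue-null sets `S`, of the
closed convex hull of `X (B(x, δ) \ S)`. -/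
def filippovMap {n : ℕ} (X : EuclideanSpace ℝ (Fin n) → EuclideanSpace ℝ (Fin n))
    (x : EuclideanSpace ℝ (Fin n)) : Set (EuclideanSpace ℝ (Fin n)) :=
  ⋂ (δ : ℝ) (_ : 0 < δ) (S : Set (EuclideanSpace ℝ (Fin n)))
    (_ : MeasureTheory.volume S = 0),
    closure (convexHull ℝ (X '' (Metric.ball x δ \ S)))

/-- `x` is a Filippov solution of `ẋ = X(x)` on `[0, ∞)`: it is absolutely continuous on every
`[0, T]`, and at almost every time `t ≥ 0` it is differentiable with derivative in the Filippov
set at `x t`. Values of `x` at negative times play no role. -/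
structure IsFilippovSolution {n : ℕ}
    (X : EuclideanSpace ℝ (Fin n) → EuclideanSpace ℝ (Fin n))
    (x : ℝ → EuclideanSpace ℝ (Fin n)) : Prop where
  absolutelyContinuous : ∀ T : ℝ, 0 ≤ T → AbsolutelyContinuousOnInterval x 0 T
  inclusion : ∀ᵐ t : ℝ, 0 ≤ t → ∃ v ∈ filippovMap X (x t), HasDerivAt x v t

/-- A weighted digraph on `n` nodes, given by its weighted adjacency matrix `(a i j)`, with
nonnegative entries and zero diagonal. -/
structure WeightedDigraph (n : ℕ) where
  a : Matrix (Fin n) (Fin n) ℝ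
  nonneg : ∀ i j, 0 ≤ a i j
  diag : ∀ i, a i i = 0

namespace WeightedDigraph

variable {n : ℕ}

/-- There is an edge from node `i` to node `j` if and only if `a j i > 0`. -/
def Edge (G : WeightedDigraph n) (i j : Fin n) : Prop := 0 < G.a j i

/-- A graph is undirected if its weighted adjacency matrix is symmetric. -/
def IsUndirected (G : WeightedDigraph n) : Prop := G.a.IsSymm

/-- Every node has exactly one outgoing edge and exactly one incoming edge. -/
def IsDirectedRing (G : WeightedDigraph n) : Prop :=
  ∀ i, (∃! j, G.Edge i j) ∧ (∃! k, G.Edge k i)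

/-- There is a root without incoming edges, every other node has exactly one incoming edge,
and there is a directed path from the root to every node. -/
def IsDirectedSpanningTree (G : WeightedDigraph n) : Prop :=
  ∃ r, (∀ j, ¬ G.Edge j r) ∧ (∀ i, i ≠ r → ∃! j, G.Edge j i) ∧
    ∀ i, Relation.ReflTransGen G.Edge r i

end WeightedDigraph

/-- The symmetric uniform quantizer with quantization step `Δ`. -/
def symQuantizer (Δ z : ℝ) : ℝ := (⌊z / Δ + 1 / 2⌋ : ℝ) * Δ

/-- The right-hand side of the consensus protocol with communication through a quantizer `q`:
`ẋ_i = ∑_j a_ij q(x_j - x_i)`. -/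
def communicationField {n : ℕ} (G : WeightedDigraph n) (q : ℝ → ℝ)
    (x : EuclideanSpace ℝ (Fin n)) : EuclideanSpace ℝ (Fin n) :=
  WithLp.toLp 2 (fun i => ∑ j, G.a i j * q (x j - x i))

/-- The set of states with `|x_i - x_j| ≤ Δ / 2` along every edge `(i, j)`. -/
def consensusSet {n : ℕ} (G : WeightedDigraph n) (Δ : ℝ) : Set (EuclideanSpace ℝ (Fin n)) :=
  {x | ∀ i j, G.Edge i j → -(1 / 2) * Δ ≤ x i - x j ∧ x i - x j ≤ 1 / 2 * Δ}

end QuantizedConsensus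

end

/-! Each case has a Lyapunov function that never increases along solutions and, off the consensus
set, decreases at a definite rate `κ`. Velocities are bounded on its initial sublevel, so the
solution is Lipschitz. Being at distance `ε` from the set thus forces a stay outside it of length
proportional to `ε`, and a fixed drop of the function. Since the function is bounded below, such
drops cannot occur at late times (`tendsto_infDist_of_lyapunov`).

For undirected graphs the function is `|x|²/2`. The quantizer is odd off a null set, which
Filippov's definition ignores, so symmetrizing the double sum exhibits the decrease
(`sum_mul_le_of_mem_filippovMap`).

In rings and trees node `i` hears only one node `p i`. With `φ` the convex primitive of the
quantizer, a Filippov velocity satisfies `v i = α i * w i`, where `w i` is a subgradient of `φ` at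
`x (p i) - x i`. The function is `∑ c i * φ (x (p i) - x i)`, with derivative `∑ c i * w i * (α (p
i) * w (p i) - α i * w i)`. On a ring `c = α` makes this minus half a sum of squares; on a tree,
weights decaying geometrically with depth let the diagonal terms absorb the cross terms. -/

namespace QuantizedConsensus

open MeasureTheory Filter

/-! ### Absolute continuity -/

/-- A function whose increments are dominated by those of an absolutely continuous function is
absolutely continuous. -/
theorem absolutelyContinuousOnInterval_of_dist_le {X Y : Type*} [PseudoMetricSpace X]
    [PseudoMetricSpace Y] {f : ℝ → X} {g : ℝ → Y} {a b C : ℝ}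
    (hf : AbsolutelyContinuousOnInterval f a b)
    (h : ∀ s ∈ Set.uIcc a b, ∀ t ∈ Set.uIcc a b, dist (g s) (g t) ≤ C * dist (f s) (f t)) :
    AbsolutelyContinuousOnInterval g a b := by
  have hC : Tendsto (fun E : ℕ × (ℕ → ℝ × ℝ) =>
      C * ∑ i ∈ Finset.range E.1, dist (f (E.2 i).1) (f (E.2 i).2))
      (AbsolutelyContinuousOnInterval.totalLengthFilter ⊓
        𝓟 (AbsolutelyContinuousOnInterval.disjWithin a b)) (nhds 0) := by
    simpa using Tendsto.const_mul C hf
  refine squeeze_zero' (Eventually.of_forall fun E => Finset.sum_nonneg fun i _ => dist_nonneg)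
    ?_ hC
  refine Eventually.filter_mono inf_le_right (eventually_principal.2 ?_)
  rintro E ⟨hE, -⟩
  rw [Finset.mul_sum]
  exact Finset.sum_le_sum fun i hi => h _ (hE i hi).1 _ (hE i hi).2

theorem absolutelyContinuousOnInterval_sum {ι : Type*} {f : ι → ℝ → ℝ} {a b : ℝ}
    (s : Finset ι) (h : ∀ i ∈ s, AbsolutelyContinuousOnInterval (f i) a b) :
    AbsolutelyContinuousOnInterval (fun t => ∑ i ∈ s, f i t) a b := by
  classical
  induction s using Finset.induction_on with
  | empty => simpa [AbsolutelyContinuousOnInterval] using tendsto_const_nhds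
  | insert i s hi ih =>
    simp only [Finset.sum_insert hi]
    exact (h i (Finset.mem_insert_self i s)).fun_add
      (ih fun j hj => h j (Finset.mem_insert_of_mem hj))

/-- An upper bound on the derivative bounds the increment of an absolutely continuous function. -/
theorem _root_.AbsolutelyContinuousOnInterval.sub_le {f : ℝ → ℝ} {a b C : ℝ} (hab : a ≤ b)
    (hf : AbsolutelyContinuousOnInterval f a b)
    (h : ∀ᵐ t : ℝ, t ∈ Set.Icc a b → deriv f t ≤ C) : f b - f a ≤ C * (b - a) := by
  rw [← hf.integral_deriv_eq_sub]
  calc ∫ t in a..b, deriv f t ≤ ∫ _ in a..b, C := by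
        refine intervalIntegral.integral_mono_ae_restrict hab hf.intervalIntegrable_deriv
          intervalIntegrable_const ?_
        exact (ae_restrict_iff' measurableSet_Icc).2 h
    _ = C * (b - a) := by simp [mul_comm]

/-! ### The quantizer and its convex potential -/

/-- The convex primitive of the symmetric quantizer. -/
noncomputable def potential (Δ z : ℝ) : ℝ := symQuantizer Δ z * z - symQuantizer Δ z ^ 2 / 2

/-- `w` is a subgradient of the quantizer potential at `z`. -/
def IsSubgradient (Δ z w : ℝ) : Prop := ∀ y, potential Δ z + w * (y - z) ≤ potential Δ y

section Quantizer

variable {Δ : ℝ}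

theorem symQuantizer_eq_round (Δ z : ℝ) : symQuantizer Δ z = round (z / Δ) * Δ := by
  rw [symQuantizer, round_eq]

theorem symQuantizer_zero (Δ : ℝ) : symQuantizer Δ 0 = 0 := by
  simp [symQuantizer_eq_round]

theorem abs_sub_symQuantizer_le (hΔ : 0 < Δ) (z : ℝ) (k : ℤ) :
    |z - symQuantizer Δ z| ≤ |z - k * Δ| := by
  have h := mul_le_mul_of_nonneg_right (round_le (z / Δ) k) hΔ.le
  rw [← abs_of_pos hΔ, ← abs_mul, ← abs_mul, abs_of_pos hΔ, sub_mul, sub_mul,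
    div_mul_cancel₀ _ hΔ.ne', ← symQuantizer_eq_round] at h
  exact h

theorem abs_sub_symQuantizer_le_half (hΔ : 0 < Δ) (z : ℝ) :
    |z - symQuantizer Δ z| ≤ Δ / 2 := by
  have h := mul_le_mul_of_nonneg_right (abs_sub_round (z / Δ)) hΔ.le
  rw [← abs_of_pos hΔ, ← abs_mul, abs_of_pos hΔ, sub_mul,
    div_mul_cancel₀ _ hΔ.ne', ← symQuantizer_eq_round] at h
  linarith

theorem abs_symQuantizer_le (hΔ : 0 < Δ) (z : ℝ) : |symQuantizer Δ z| ≤ |z| + Δ / 2 := by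
  have h := abs_sub_symQuantizer_le_half hΔ z
  have := abs_sub_abs_le_abs_sub (symQuantizer Δ z) z
  rw [abs_sub_comm] at this
  linarith

/-- The left side is `(z² - (z - kΔ)²) / 2`, largest when `kΔ` is a multiple of `Δ` nearest to `z`.
So the potential is a maximum of affine functions, hence convex. -/
theorem le_potential (hΔ : 0 < Δ) (z : ℝ) (k : ℤ) :
    k * Δ * z - (k * Δ) ^ 2 / 2 ≤ potential Δ z := by
  have h := sq_le_sq.2 (abs_sub_symQuantizer_le hΔ z k)
  unfold potential
  nlinarith

theorem potential_nonneg (hΔ : 0 < Δ) (z : ℝ) : 0 ≤ potential Δ z := by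
  simpa using le_potential hΔ z 0

theorem potential_zero (Δ : ℝ) : potential Δ 0 = 0 := by
  simp [potential, symQuantizer_zero]

theorem le_potential_abs (hΔ : 0 < Δ) (z : ℝ) : Δ * (|z| - Δ / 2) ≤ potential Δ z := by
  have h₁ := le_potential hΔ z 1
  have h₂ := le_potential hΔ z (-1)
  push_cast at h₁ h₂
  rcases abs_cases z with ⟨h, -⟩ | ⟨h, -⟩ <;> rw [h] <;> nlinarith

theorem isSubgradient_symQuantizer (hΔ : 0 < Δ) (z : ℝ) :
    IsSubgradient Δ z (symQuantizer Δ z) := by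
  intro y
  have h := le_potential hΔ y (round (z / Δ))
  rw [← symQuantizer_eq_round] at h
  have : potential Δ z = symQuantizer Δ z * z - symQuantizer Δ z ^ 2 / 2 := rfl
  rw [this]
  linarith

/-- The slope at `z'` is almost a subgradient at a nearby `z`. The error vanishes as `z'` tends to
`z`, even across a jump. -/
theorem symQuantizer_mul_sub_le (hΔ : 0 < Δ) (z z' y : ℝ) :
    symQuantizer Δ z' * (y - z) ≤
      potential Δ y - potential Δ z + (|z' - z| + Δ) * |z' - z| := by
  have h₁ := isSubgradient_symQuantizer hΔ z' y
  have h₂ := isSubgradient_symQuantizer hΔ z z'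
  have h₃ : |symQuantizer Δ z' - symQuantizer Δ z| ≤ |z' - z| + Δ := by
    have e : symQuantizer Δ z' - symQuantizer Δ z =
      (z - symQuantizer Δ z) - (z' - symQuantizer Δ z') + (z' - z) := by ring
    rw [e]
    have := abs_sub_symQuantizer_le_half hΔ z
    have := abs_sub_symQuantizer_le_half hΔ z'
    have := abs_add_le ((z - symQuantizer Δ z) - (z' - symQuantizer Δ z')) (z' - z)
    have := abs_sub (z - symQuantizer Δ z) (z' - symQuantizer Δ z')
    linarith
  have h₄ : (symQuantizer Δ z' - symQuantizer Δ z) * (z' - z) ≤ (|z' - z| + Δ) * |z' - z| := by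
    refine (le_abs_self _).trans ?_
    rw [abs_mul]
    exact mul_le_mul_of_nonneg_right h₃ (abs_nonneg _)
  nlinarith

theorem abs_potential_sub_le (hΔ : 0 < Δ) {y z C : ℝ} (hy : |y| ≤ C) (hz : |z| ≤ C) :
    |potential Δ y - potential Δ z| ≤ (C + Δ / 2) * |y - z| := by
  have key : ∀ u v : ℝ, |u| ≤ C →
      potential Δ u - potential Δ v ≤ (C + Δ / 2) * |u - v| := by
    intro u v hu
    have h := isSubgradient_symQuantizer hΔ u v
    have h' : symQuantizer Δ u * (u - v) ≤ (C + Δ / 2) * |u - v| := by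
      refine (le_abs_self _).trans ?_
      rw [abs_mul]
      refine mul_le_mul_of_nonneg_right ?_ (abs_nonneg _)
      linarith [abs_symQuantizer_le hΔ u]
    linarith
  rw [abs_le]
  have h₁ := key y z hy
  have h₂ := key z y hz
  rw [abs_sub_comm z y] at h₂
  constructor <;> linarith

namespace IsSubgradient

variable {z w : ℝ}

theorem mul_nonneg (hΔ : 0 < Δ) (h : IsSubgradient Δ z w) : 0 ≤ w * z := by
  have := h 0
  rw [potential_zero] at this
  linarith [potential_nonneg hΔ z]

theorem eq_zero (hΔ : 0 < Δ) (h : IsSubgradient Δ 0 w) : w = 0 := by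
  have e : ∀ y, |y| < Δ / 2 → potential Δ y = 0 := by
    intro y hy
    have : round (y / Δ) = 0 := by
      rw [round_eq_zero_iff]
      rw [abs_lt] at hy
      constructor
      · rw [le_div_iff₀ hΔ]; linarith
      · rw [div_lt_iff₀ hΔ]; linarith
    simp [potential, symQuantizer_eq_round, this]
  have h₁ := h (Δ / 4)
  have h₂ := h (-(Δ / 4))
  have h₃ : |Δ / 4| < Δ / 2 := by rw [abs_of_pos (by linarith)]; linarith
  rw [potential_zero, e _ h₃] at h₁
  rw [potential_zero, e _ (by rwa [abs_neg])] at h₂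
  nlinarith

/-- Test the subgradient at `Δ / 2`, where the potential is still zero, against the affine minorant
of slope `Δ`. -/
theorem le_of_lt (hΔ : 0 < Δ) (h : IsSubgradient Δ z w) (hz : Δ / 2 < z) : Δ ≤ w := by
  have h₁ := h (Δ / 2)
  have h₂ := le_potential hΔ z 1
  have h₃ : potential Δ (Δ / 2) = 0 := by
    have : round (Δ / 2 / Δ) = 1 := by
      rw [round_eq, div_right_comm, div_self hΔ.ne']; norm_num
    simp [potential, symQuantizer_eq_round, this]; ring
  push_cast at h₂
  nlinarith

theorem le_neg_of_lt (hΔ : 0 < Δ) (h : IsSubgradient Δ z w) (hz : z < -(Δ / 2)) : w ≤ -Δ := by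
  have h₁ := h (-(Δ / 2))
  have h₂ := le_potential hΔ z (-1)
  have h₃ : potential Δ (-(Δ / 2)) = 0 := by
    have : round (-(Δ / 2) / Δ) = 0 := by
      rw [round_eq, neg_div, div_right_comm, div_self hΔ.ne']; norm_num
    simp [potential, symQuantizer_eq_round, this]
  push_cast at h₂
  nlinarith

theorem le_abs (hΔ : 0 < Δ) (h : IsSubgradient Δ z w) (hz : Δ / 2 < |z|) : Δ ≤ |w| := by
  rcases lt_abs.1 hz with hz | hz
  · exact (h.le_of_lt hΔ hz).trans (le_abs_self w)
  · have := h.le_neg_of_lt hΔ (by linarith)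
    linarith [neg_le_abs w]

/-- Chain rule for the potential along a curve: where the composition is differentiable, every
subgradient computes its derivative. -/
theorem hasDerivAt {f : ℝ → ℝ} {t f' : ℝ} (h : IsSubgradient Δ (f t) w)
    (hf : HasDerivAt f f' t) (hd : DifferentiableAt ℝ (fun s => potential Δ (f s)) t) :
    HasDerivAt (fun s => potential Δ (f s)) (w * f') t := by
  -- The subgradient inequality makes `t` a minimum of this difference, so its derivative vanishes
  -- there.
  have hmin : IsLocalMin (fun s => potential Δ (f s) - w * f s) t :=
    Eventually.of_forall fun s => by
      have := h (f s)
      simp only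
      linarith
  have h0 := hmin.hasDerivAt_eq_zero (hd.hasDerivAt.sub (hf.const_mul w))
  have : deriv (fun s => potential Δ (f s)) t = w * f' := by linarith
  exact this ▸ hd.hasDerivAt

end IsSubgradient

end Quantizer

/-! ### The Filippov map -/

/-- A closed half-space that contains the essential limit values of `X` at `x` contains the Filippov
set at `x`. -/
theorem le_of_mem_filippovMap {n : ℕ} {X : EuclideanSpace ℝ (Fin n) → EuclideanSpace ℝ (Fin n)}
    {x v : EuclideanSpace ℝ (Fin n)} (hv : v ∈ filippovMap X x)
    (l : EuclideanSpace ℝ (Fin n) →L[ℝ] ℝ) {β : ℝ}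
    (h : ∀ ε > 0, ∃ δ > 0, ∀ᵐ y, dist y x < δ → l (X y) ≤ β + ε) : l v ≤ β := by
  refine le_of_forall_pos_le_add fun ε hε => ?_
  obtain ⟨δ, hδ, hy⟩ := h ε hε
  simp only [filippovMap, Set.mem_iInter] at hv
  -- The null set removed is the one where the bound fails.
  have hv' := hv δ hδ _ (ae_iff.1 hy)
  have hsub : closure (convexHull ℝ (X '' (Metric.ball x δ \ {y | ¬(dist y x < δ → l (X y) ≤ β + ε)})))
      ⊆ {u | l u ≤ β + ε} := by
    refine closure_minimal (convexHull_min ?_ (convex_halfSpace_le l.toLinearMap.isLinear _))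
      (isClosed_le l.continuous continuous_const)
    rintro _ ⟨y, ⟨hyb, hyS⟩, rfl⟩
    exact not_not.1 hyS hyb
  exact hsub hv'

theorem abs_sub_apply_sub_le {n : ℕ} (x y : EuclideanSpace ℝ (Fin n)) (i j : Fin n) :
    |(y j - y i) - (x j - x i)| ≤ 2 * dist y x := by
  have h₁ := PiLp.norm_apply_le (y - x) i
  have h₂ := PiLp.norm_apply_le (y - x) j
  rw [← dist_eq_norm, Real.norm_eq_abs, PiLp.sub_apply] at h₁ h₂
  have := abs_sub (y j - x j) (y i - x i)
  have e : (y j - y i) - (x j - x i) = (y j - x j) - (y i - x i) := by ring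
  rw [e]
  linarith

theorem communicationField_apply {n : ℕ} (G : WeightedDigraph n) (q : ℝ → ℝ)
    (x : EuclideanSpace ℝ (Fin n)) (i : Fin n) :
    communicationField G q x i = ∑ j, G.a i j * q (x j - x i) := rfl

/-- Bound on the velocities allowed by the Filippov map. -/
theorem abs_apply_le_of_mem_filippovMap {n : ℕ} {G : WeightedDigraph n} {Δ : ℝ} (hΔ : 0 < Δ)
    {x v : EuclideanSpace ℝ (Fin n)}
    (hv : v ∈ filippovMap (communicationField G (symQuantizer Δ)) x) (i : Fin n) :
    |v i| ≤ ∑ j, G.a i j * (|x j - x i| + Δ) := by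
  -- Within `Δ / 4` a difference of coordinates moves by at most `Δ / 2`; rounding costs another `Δ
  -- / 2`.
  have key : ∀ y : EuclideanSpace ℝ (Fin n), dist y x < Δ / 4 →
      |communicationField G (symQuantizer Δ) y i| ≤ ∑ j, G.a i j * (|x j - x i| + Δ) := by
    intro y hy
    rw [communicationField_apply]
    refine (Finset.abs_sum_le_sum_abs _ _).trans (Finset.sum_le_sum fun j _ => ?_)
    rw [abs_mul, abs_of_nonneg (G.nonneg i j)]
    refine mul_le_mul_of_nonneg_left ?_ (G.nonneg i j)
    have h₁ := abs_symQuantizer_le hΔ (y j - y i)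
    have h₂ := abs_sub_apply_sub_le x y i j
    have h₃ := abs_sub_abs_le_abs_sub (y j - y i) (x j - x i)
    linarith
  rw [abs_le']
  constructor
  · refine le_of_mem_filippovMap hv (EuclideanSpace.proj i) fun ε hε =>
      ⟨Δ / 4, by linarith, Eventually.of_forall fun y hy => ?_⟩
    have := (abs_le'.1 (key y hy)).1
    simp only [PiLp.proj_apply]
    linarith
  · refine le_of_mem_filippovMap hv (-EuclideanSpace.proj i) fun ε hε =>
      ⟨Δ / 4, by linarith, Eventually.of_forall fun y hy => ?_⟩
    have := (abs_le'.1 (key y hy)).2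
    simp only [neg_apply, PiLp.proj_apply]
    linarith

/-- A small neighbourhood makes the error term of the quantizer inequality small. -/
theorem exists_pos_forall_error_le {Δ ε : ℝ} (hΔ : 0 < Δ) (hε : 0 < ε) :
    ∃ δ > 0, ∀ s, 0 ≤ s → s < 2 * δ → (s + Δ) * s ≤ ε := by
  refine ⟨min (Δ / 2) (ε / (4 * Δ)), by positivity, fun s hs h => ?_⟩
  have h₁ : s ≤ Δ := by linarith [min_le_left (Δ / 2) (ε / (4 * Δ))]
  have h₂ : s ≤ ε / (2 * Δ) := by
    have : 2 * (ε / (4 * Δ)) = ε / (2 * Δ) := by field_simp; ring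
    linarith [min_le_right (Δ / 2) (ε / (4 * Δ))]
  rw [le_div_iff₀ (by positivity)] at h₂
  nlinarith

/-- For each fixed test point the subgradient inequality is a closed half-space condition on `v`, so
it survives limits and convex hulls. -/
theorem isSubgradient_of_mem_filippovMap {n : ℕ} {Δ : ℝ} (hΔ : 0 < Δ)
    {X : EuclideanSpace ℝ (Fin n) → EuclideanSpace ℝ (Fin n)} {i p : Fin n} {α : ℝ} (hα : 0 < α)
    (hX : ∀ y, X y i = α * symQuantizer Δ (y p - y i)) {x v : EuclideanSpace ℝ (Fin n)}
    (hv : v ∈ filippovMap X x) : IsSubgradient Δ (x p - x i) (v i / α) := by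
  intro y
  have key : v i * (y - (x p - x i)) ≤ α * (potential Δ y - potential Δ (x p - x i)) := by
    have := le_of_mem_filippovMap (β := α * (potential Δ y - potential Δ (x p - x i))) hv
      ((y - (x p - x i)) • EuclideanSpace.proj i) fun ε hε => by
      obtain ⟨δ, hδ, hs⟩ := exists_pos_forall_error_le hΔ (div_pos hε hα)
      refine ⟨δ, hδ, Eventually.of_forall fun y' hy' => ?_⟩
      have h₁ := symQuantizer_mul_sub_le hΔ (x p - x i) (y' p - y' i) y
      have h₂ := hs _ (abs_nonneg ((y' p - y' i) - (x p - x i)))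
        ((abs_sub_apply_sub_le x y' i p).trans_lt (by linarith))
      have h₃ := mul_le_mul_of_nonneg_left (h₁.trans (add_le_add_right h₂ _)) hα.le
      rw [mul_add, mul_div_cancel₀ _ hα.ne'] at h₃
      simp only [smul_apply, PiLp.proj_apply, hX, smul_eq_mul]
      linarith
    simpa [mul_comm] using this
  have : v i / α * (y - (x p - x i)) ≤ potential Δ y - potential Δ (x p - x i) := by
    rw [div_mul_eq_mul_div, div_le_iff₀ hα]
    linarith
  linarith

/-! ### Convergence from a Lyapunov function -/

theorem exists_pos_forall_le {ι : Type*} [Finite ι] (f : ι → ℝ) (hf : ∀ i, 0 < f i) :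
    ∃ m > 0, ∀ i, m ≤ f i := by
  cases isEmpty_or_nonempty ι
  · exact ⟨1, one_pos, fun i => isEmptyElim i⟩
  · obtain ⟨i, hi⟩ := Finite.exists_min f
    exact ⟨f i, hf i, hi⟩

theorem exists_edge_of_notMem_consensusSet {n : ℕ} {G : WeightedDigraph n} {Δ : ℝ}
    {x : EuclideanSpace ℝ (Fin n)} (h : x ∉ consensusSet G Δ) :
    ∃ i j, G.Edge i j ∧ Δ / 2 < |x i - x j| := by
  by_contra! hc
  refine h fun i j hij => ?_
  have := abs_le.1 (hc i j hij)
  constructor <;> linarith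

theorem _root_.AbsolutelyContinuousOnInterval.euclidean_apply {n : ℕ} {x : ℝ → EuclideanSpace ℝ (Fin n)}
    {a b : ℝ} (hx : AbsolutelyContinuousOnInterval x a b) (i : Fin n) :
    AbsolutelyContinuousOnInterval (fun t => x t i) a b :=
  absolutelyContinuousOnInterval_of_dist_le (C := 1) hx fun s _ t _ => by
    rw [one_mul, dist_eq_norm (x s), Real.dist_eq, ← PiLp.sub_apply]
    exact PiLp.norm_apply_le (x s - x t) i

theorem hasDerivAt_euclidean_apply {n : ℕ} {x : ℝ → EuclideanSpace ℝ (Fin n)}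
    {v : EuclideanSpace ℝ (Fin n)} {t : ℝ} (h : HasDerivAt x v t) (i : Fin n) :
    HasDerivAt (fun s => x s i) (v i) t :=
  (EuclideanSpace.proj i : EuclideanSpace ℝ (Fin n) →L[ℝ] ℝ).hasFDerivAt.comp_hasDerivAt t h

/-- A curve whose velocity is bounded coordinatewise is Lipschitz. -/
theorem dist_le_of_deriv_bound {n : ℕ} {x : ℝ → EuclideanSpace ℝ (Fin n)} {s t L : ℝ}
    (hst : s ≤ t) (hL : 0 ≤ L) (hx : AbsolutelyContinuousOnInterval x s t)
    (h : ∀ᵐ r : ℝ, r ∈ Set.Icc s t → ∃ v, HasDerivAt x v r ∧ ∀ i, |v i| ≤ L) :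
    dist (x t) (x s) ≤ (n + 1) * L * (t - s) := by
  have hi : ∀ i, |x t i - x s i| ≤ L * (t - s) := by
    intro i
    rw [abs_le']
    constructor
    · refine (hx.euclidean_apply i).sub_le hst ?_
      filter_upwards [h] with r hr hrI
      obtain ⟨v, hv, hvL⟩ := hr hrI
      rw [(hasDerivAt_euclidean_apply hv i).deriv]
      exact (abs_le.1 (hvL i)).2
    · have : AbsolutelyContinuousOnInterval (fun r => -x r i) s t := (hx.euclidean_apply i).fun_neg
      have := this.sub_le (C := L) hst (by
        filter_upwards [h] with r hr hrI
        obtain ⟨v, hv, hvL⟩ := hr hrI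
        rw [(hasDerivAt_euclidean_apply hv i).fun_neg.deriv]
        linarith [(abs_le.1 (hvL i)).1])
      linarith
  have h0 : 0 ≤ L * (t - s) := mul_nonneg hL (by linarith)
  rw [dist_eq_norm]
  refine abs_le_of_sq_le_sq' ?_ (by rw [mul_assoc]; positivity) |>.2
  rw [EuclideanSpace.norm_sq_eq]
  calc ∑ i, ‖(x t - x s) i‖ ^ 2 ≤ ∑ _i : Fin n, (L * (t - s)) ^ 2 :=
        Finset.sum_le_sum fun i _ => pow_le_pow_left₀ (norm_nonneg _) (hi i) 2
    _ = n * (L * (t - s)) ^ 2 := by simp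
    _ ≤ ((n + 1) * L * (t - s)) ^ 2 := by
        have hn : (0 : ℝ) ≤ n := Nat.cast_nonneg n
        have : ((n + 1) * L * (t - s)) ^ 2 = (n + 1 : ℝ) ^ 2 * (L * (t - s)) ^ 2 := by ring
        rw [this]
        refine mul_le_mul_of_nonneg_right ?_ (sq_nonneg _)
        nlinarith

/-- `hD` bounds velocities on the initial sublevel of `V`; the resulting Lipschitz bound on `x`
replaces any invariance principle. -/
theorem tendsto_infDist_of_lyapunov {n : ℕ} {G : WeightedDigraph n} {Δ : ℝ} (hΔ : 0 < Δ)
    {x : ℝ → EuclideanSpace ℝ (Fin n)}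
    (hx : IsFilippovSolution (communicationField G (symQuantizer Δ)) x) (V : ℝ → ℝ) {κ D : ℝ}
    (hκ : 0 < κ) (hV : ∀ t, 0 ≤ t → 0 ≤ V t)
    (hac : ∀ T, 0 ≤ T → AbsolutelyContinuousOnInterval V 0 T)
    (hd : ∀ᵐ t : ℝ, 0 ≤ t → deriv V t ≤ 0 ∧ (x t ∉ consensusSet G Δ → deriv V t ≤ -κ))
    (hD : ∀ t, 0 ≤ t → V t ≤ V 0 → ∀ i j, 0 < G.a i j → |x t j - x t i| ≤ D) :
    Tendsto (fun t => Metric.infDist (x t) (consensusSet G Δ)) atTop (nhds 0) := by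
  have hsub : ∀ {s t : ℝ}, 0 ≤ s → s ≤ t → Set.uIcc s t ⊆ Set.uIcc 0 t := fun {s t} hs hst => by
    rw [Set.uIcc_of_le hst, Set.uIcc_of_le (hs.trans hst)]
    exact Set.Icc_subset_Icc_left hs
  have hacst : ∀ {s t : ℝ}, 0 ≤ s → s ≤ t → AbsolutelyContinuousOnInterval V s t :=
    fun {s t} hs hst => (hac t (hs.trans hst)).mono (hsub hs hst)
  have anti : ∀ s t, 0 ≤ s → s ≤ t → V t ≤ V s := by
    intro s t hs hst
    have := (hacst hs hst).sub_le (C := 0) hst (by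
      filter_upwards [hd] with r hr hrI
      exact (hr (hs.trans hrI.1)).1)
    linarith
  set L : ℝ := 1 + ∑ i, ∑ j, G.a i j * (|D| + Δ) with hLdef
  have hterm : ∀ i j, 0 ≤ G.a i j * (|D| + Δ) := fun i j =>
    mul_nonneg (G.nonneg i j) (by positivity)
  have hL : 0 < L := by
    have : 0 ≤ ∑ i, ∑ j, G.a i j * (|D| + Δ) :=
      Finset.sum_nonneg fun i _ => Finset.sum_nonneg fun j _ => hterm i j
    linarith
  have hvel : ∀ t, 0 ≤ t → ∀ v ∈ filippovMap (communicationField G (symQuantizer Δ)) (x t),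
      ∀ i, |v i| ≤ L := by
    intro t ht v hv i
    have h₁ : ∑ j, G.a i j * (|x t j - x t i| + Δ) ≤ ∑ j, G.a i j * (|D| + Δ) := by
      refine Finset.sum_le_sum fun j _ => ?_
      rcases (G.nonneg i j).eq_or_lt with h | h
      · simp [← h]
      · have := (hD t ht (anti 0 t le_rfl ht) i j h).trans (le_abs_self D)
        exact mul_le_mul_of_nonneg_left (by linarith) h.le
    have h₂ : ∑ j, G.a i j * (|D| + Δ) ≤ ∑ i, ∑ j, G.a i j * (|D| + Δ) :=
      Finset.single_le_sum (f := fun i => ∑ j, G.a i j * (|D| + Δ))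
        (fun i _ => Finset.sum_nonneg fun j _ => hterm i j) (Finset.mem_univ i)
    linarith [abs_apply_le_of_mem_filippovMap hΔ hv i]
  set K : ℝ := (n + 1) * L with hKdef
  have hK : 0 < K := by positivity
  have hlip : ∀ s t, 0 ≤ s → s ≤ t → dist (x t) (x s) ≤ K * (t - s) := by
    intro s t hs hst
    refine dist_le_of_deriv_bound hst hL.le
      ((hx.absolutelyContinuous t (hs.trans hst)).mono (hsub hs hst)) ?_
    filter_upwards [hx.inclusion] with r hr hrI
    obtain ⟨v, hv, hv'⟩ := hr (hs.trans hrI.1)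
    exact ⟨v, hv', hvel r (hs.trans hrI.1) v hv⟩
  rw [Metric.tendsto_atTop]
  intro ε hε
  -- In time `h` the solution moves at most `ε / 2`, so it cannot reach the set from distance `ε`.
  set h : ℝ := ε / (2 * K) with hh
  have hh0 : 0 < h := by positivity
  have hne : (V '' Set.Ici 0).Nonempty := ⟨V 0, 0, Set.self_mem_Ici, rfl⟩
  have hbdd : BddBelow (V '' Set.Ici 0) := ⟨0, by rintro _ ⟨t, ht, rfl⟩; exact hV t ht⟩
  -- After `T` a further drop of `κ * h` would take `V` below its infimum.
  obtain ⟨_, ⟨T, hT, rfl⟩, hVT⟩ :=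
    exists_lt_of_csInf_lt hne (lt_add_of_pos_right (sInf (V '' Set.Ici 0)) (mul_pos hκ hh0))
  refine ⟨T, fun t htT => ?_⟩
  have ht : 0 ≤ t := le_trans hT htT
  rw [Real.dist_0_eq_abs, abs_of_nonneg Metric.infDist_nonneg]
  by_contra! hfar
  have hout : ∀ s ∈ Set.Icc t (t + h), x s ∉ consensusSet G Δ := by
    intro s hs hmem
    have h₁ := Metric.infDist_le_dist_of_mem (x := x t) hmem
    have h₂ := hlip t s ht hs.1
    have h₃ : K * (s - t) ≤ K * h := mul_le_mul_of_nonneg_left (by linarith [hs.2]) hK.le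
    have h₄ : K * h = ε / 2 := by rw [hh]; field_simp
    rw [dist_comm] at h₂
    linarith
  have hdec := (hacst ht (by linarith : t ≤ t + h)).sub_le (C := -κ) (by linarith) (by
    filter_upwards [hd] with r hr hrI
    exact (hr (ht.trans hrI.1)).2 (hout r hrI))
  have h₁ : sInf (V '' Set.Ici 0) ≤ V (t + h) :=
    csInf_le hbdd ⟨t + h, by simp only [Set.mem_Ici]; linarith, rfl⟩
  have h₂ := anti T t hT htT
  have h₃ : t + h - t = h := by ring
  rw [h₃] at hdec
  linarith

/-! ### Undirected graphs -/

/-- Oddness can fail only at the midpoints between multiples of `Δ`, where ties round up. -/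
theorem symQuantizer_neg {Δ z : ℝ} (hΔ : 0 < Δ)
    (hz : z ∉ Set.range fun k : ℤ => (k - 1 / 2 : ℝ) * Δ) :
    symQuantizer Δ (-z) = -symQuantizer Δ z := by
  have h₁ := Int.floor_le (z / Δ + 1 / 2)
  have h₂ := Int.lt_floor_add_one (z / Δ + 1 / 2)
  have h₃ : (⌊z / Δ + 1 / 2⌋ : ℝ) ≠ z / Δ + 1 / 2 := fun h =>
    hz ⟨⌊z / Δ + 1 / 2⌋, by simp only [h]; field_simp; ring⟩
  have h₄ := lt_of_le_of_ne h₁ h₃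
  have : ⌊-z / Δ + 1 / 2⌋ = -⌊z / Δ + 1 / 2⌋ := by
    rw [Int.floor_eq_iff, neg_div]
    push_cast
    constructor <;> linarith
  rw [symQuantizer, symQuantizer, this]
  push_cast
  ring

theorem ae_symQuantizer_antisymm {n : ℕ} {Δ : ℝ} (hΔ : 0 < Δ) :
    ∀ᵐ y : EuclideanSpace ℝ (Fin n), ∀ i j,
      symQuantizer Δ (y j - y i) = -symQuantizer Δ (y i - y j) := by
  refine ae_all_iff.2 fun i => ae_all_iff.2 fun j => ?_
  rcases eq_or_ne i j with rfl | hij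
  · exact Eventually.of_forall fun y => by simp [symQuantizer_zero]
  let f : EuclideanSpace ℝ (Fin n) →ₗ[ℝ] ℝ :=
    (EuclideanSpace.proj i - EuclideanSpace.proj j : EuclideanSpace ℝ (Fin n) →L[ℝ] ℝ)
  have hf : Function.Surjective f := fun c =>
    ⟨EuclideanSpace.single i c, by simp [f, hij.symm]⟩
  have hnull : ∀ᵐ u : ℝ, u ∉ Set.range fun k : ℤ => (k - 1 / 2 : ℝ) * Δ :=
    (Set.countable_range _).ae_notMem _
  have := (ae_comp_linearMap_mem_iff f volume volume hf
    (Set.countable_range fun k : ℤ => (k - 1 / 2 : ℝ) * Δ).measurableSet.compl).2 hnull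
  filter_upwards [this] with y hy
  have e : y j - y i = -(y i - y j) := by ring
  rw [e]
  exact symQuantizer_neg hΔ hy

/-- Near `z` the quantizer keeps the sign of `z`, with a definite size beyond the threshold. -/
theorem eventually_le_mul_symQuantizer {Δ : ℝ} (hΔ : 0 < Δ) (z : ℝ) :
    ∀ᶠ z' in nhds z, (if Δ / 2 < |z| then Δ ^ 2 / 2 else 0) ≤ z * symQuantizer Δ z' := by
  have hs := fun z' => isSubgradient_symQuantizer hΔ z'
  rcases lt_trichotomy z 0 with hz | rfl | hz
  · split_ifs with h
    · rw [abs_of_neg hz] at h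
      filter_upwards [gt_mem_nhds (show z < -(Δ / 2) by linarith)] with z' hz'
      have := (hs z').le_neg_of_lt hΔ hz'
      nlinarith
    · filter_upwards [gt_mem_nhds hz] with z' hz'
      exact mul_nonneg_of_nonpos_of_nonpos hz.le
        (nonpos_of_mul_nonneg_left ((hs z').mul_nonneg hΔ) hz')
  · simp [show ¬ Δ / 2 < 0 by linarith]
  · split_ifs with h
    · rw [abs_of_pos hz] at h
      filter_upwards [lt_mem_nhds h] with z' hz'
      have := (hs z').le_of_lt hΔ hz'
      nlinarith
    · filter_upwards [lt_mem_nhds hz] with z' hz'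
      exact mul_nonneg hz.le (nonneg_of_mul_nonneg_left ((hs z').mul_nonneg hΔ) hz')

/-- Freeze the coefficients at `x` and evaluate the field at nearby `y`. Swapping `i` and `j` then
yields `-1/2 ∑ a i j * (x j - x i) * q (y j - y i)`, whose terms are bounded by the sign of the
quantizer near `x j - x i`. -/
theorem sum_mul_le_of_mem_filippovMap {n : ℕ} {G : WeightedDigraph n} (hG : G.IsUndirected)
    {Δ : ℝ} (hΔ : 0 < Δ) {x v : EuclideanSpace ℝ (Fin n)}
    (hv : v ∈ filippovMap (communicationField G (symQuantizer Δ)) x) :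
    ∑ i, x i * v i ≤
      -(∑ i, ∑ j, G.a i j * (if Δ / 2 < |x j - x i| then Δ ^ 2 / 2 else 0)) / 2 := by
  have hsymm : ∀ i j, G.a i j = G.a j i := fun i j => hG.apply j i
  have key : ∀ᶠ y in nhds x, ∀ i j, (if Δ / 2 < |x j - x i| then Δ ^ 2 / 2 else 0) ≤
      (x j - x i) * symQuantizer Δ (y j - y i) := by
    refine eventually_all.2 fun i => eventually_all.2 fun j => ?_
    have hc : ContinuousAt (fun y : EuclideanSpace ℝ (Fin n) => y j - y i) x := by fun_prop
    exact hc.eventually (eventually_le_mul_symQuantizer hΔ (x j - x i))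
  obtain ⟨δ, hδ, hball⟩ := Metric.eventually_nhds_iff.1 key
  have := le_of_mem_filippovMap hv (∑ i, x i • EuclideanSpace.proj i)
    (β := -(∑ i, ∑ j, G.a i j * (if Δ / 2 < |x j - x i| then Δ ^ 2 / 2 else 0)) / 2)
    fun ε hε => by
    refine ⟨δ, hδ, ?_⟩
    filter_upwards [ae_symQuantizer_antisymm hΔ] with y hy hyx
    have hy' := hball hyx
    simp only [sum_apply, smul_apply, PiLp.proj_apply, smul_eq_mul,
      communicationField_apply]
    have e₁ : ∑ i, x i * ∑ j, G.a i j * symQuantizer Δ (y j - y i) =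
        ∑ i, ∑ j, G.a i j * (x i * symQuantizer Δ (y j - y i)) := by
      refine Finset.sum_congr rfl fun i _ => ?_
      rw [Finset.mul_sum]
      exact Finset.sum_congr rfl fun j _ => by ring
    have e₂ : ∑ i, ∑ j, G.a i j * (x i * symQuantizer Δ (y j - y i)) =
        -∑ i, ∑ j, G.a i j * (x j * symQuantizer Δ (y j - y i)) := by
      rw [Finset.sum_comm, ← Finset.sum_neg_distrib]
      refine Finset.sum_congr rfl fun i _ => ?_
      rw [← Finset.sum_neg_distrib]
      refine Finset.sum_congr rfl fun j _ => ?_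
      rw [hy i j, hsymm i j]
      ring
    have e₃ : ∑ i, ∑ j, G.a i j * (if Δ / 2 < |x j - x i| then Δ ^ 2 / 2 else 0) ≤
        ∑ i, ∑ j, G.a i j * (x j * symQuantizer Δ (y j - y i)) -
          ∑ i, ∑ j, G.a i j * (x i * symQuantizer Δ (y j - y i)) := by
      rw [← Finset.sum_sub_distrib]
      refine Finset.sum_le_sum fun i _ => ?_
      rw [← Finset.sum_sub_distrib]
      refine Finset.sum_le_sum fun j _ => ?_
      have := mul_le_mul_of_nonneg_left (hy' i j) (G.nonneg i j)
      linarith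
    rw [e₁]
    linarith
  simpa using this

theorem tendsto_infDist_of_isUndirected {n : ℕ} {G : WeightedDigraph n} (hG : G.IsUndirected)
    {Δ : ℝ} (hΔ : 0 < Δ) {x : ℝ → EuclideanSpace ℝ (Fin n)}
    (hx : IsFilippovSolution (communicationField G (symQuantizer Δ)) x) :
    Tendsto (fun t => Metric.infDist (x t) (consensusSet G Δ)) atTop (nhds 0) := by
  -- `m` bounds the positive weights from below; absent edges get the dummy value `1`.
  obtain ⟨m, hm, hma⟩ := exists_pos_forall_le
    (fun e : Fin n × Fin n => if 0 < G.a e.1 e.2 then G.a e.1 e.2 else 1)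
    (fun e => by split_ifs with h; exacts [h, one_pos])
  refine tendsto_infDist_of_lyapunov hΔ hx (fun t => ∑ i, 1 / 2 * (x t i * x t i))
    (κ := m * Δ ^ 2 / 4) (D := 2 * (1 + ∑ i, 1 / 2 * (x 0 i * x 0 i)) ) (by positivity)
    (fun t _ => Finset.sum_nonneg fun i _ => by have := mul_self_nonneg (x t i); positivity)
    (fun T hT => absolutelyContinuousOnInterval_sum _ fun i _ =>
      (((hx.absolutelyContinuous T hT).euclidean_apply i).fun_mul
        ((hx.absolutelyContinuous T hT).euclidean_apply i)).const_mul _) ?_ ?_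
  · filter_upwards [hx.inclusion] with t ht ht0
    obtain ⟨v, hv, hv'⟩ := ht ht0
    have hder : HasDerivAt (fun t => ∑ i, 1 / 2 * (x t i * x t i)) (∑ i, x t i * v i) t := by
      refine HasDerivAt.fun_sum fun i _ => ?_
      have := hasDerivAt_euclidean_apply hv' i
      exact ((this.mul this).const_mul (1 / 2)).congr_deriv (by ring)
    rw [hder.deriv]
    have hle := sum_mul_le_of_mem_filippovMap hG hΔ hv
    have hnn : ∀ i j, 0 ≤ G.a i j * (if Δ / 2 < |x t j - x t i| then Δ ^ 2 / 2 else 0) :=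
      fun i j => mul_nonneg (G.nonneg i j) (by split_ifs <;> positivity)
    have hsum : ∀ i, 0 ≤ ∑ j, G.a i j * (if Δ / 2 < |x t j - x t i| then Δ ^ 2 / 2 else 0) :=
      fun i => Finset.sum_nonneg fun j _ => hnn i j
    refine ⟨hle.trans ?_, fun hmem => hle.trans ?_⟩
    · have := Finset.sum_nonneg fun i (_ : i ∈ Finset.univ) => hsum i
      linarith
    · obtain ⟨j, i, hji, hfar⟩ := exists_edge_of_notMem_consensusSet hmem
      have h₁ := Finset.single_le_sum (fun i _ => hsum i) (Finset.mem_univ i)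
      have h₂ := Finset.single_le_sum (fun j _ => hnn i j) (Finset.mem_univ j)
      have h₃ := hma (i, j)
      simp only [if_pos hfar] at h₂
      simp only [show 0 < G.a i j from hji, if_true] at h₃
      have h₄ := mul_le_mul_of_nonneg_right h₃ (show 0 ≤ Δ ^ 2 / 2 by positivity)
      linarith
  · intro t _ hVt i j _
    have hnn : ∀ i, 0 ≤ 1 / 2 * (x t i * x t i) := fun i => by
      have := mul_self_nonneg (x t i); positivity
    have hb : ∀ i, |x t i| ≤ 1 + ∑ i, 1 / 2 * (x 0 i * x 0 i) := fun i => by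
      have h₁ := Finset.single_le_sum (fun i _ => hnn i) (Finset.mem_univ i)
      have h₂ : 1 / 2 * (x t i * x t i) ≤ ∑ i, 1 / 2 * (x 0 i * x 0 i) := h₁.trans hVt
      have h₃ : x t i * x t i = |x t i| * |x t i| := (abs_mul_abs_self _).symm
      nlinarith [sq_nonneg (|x t i| - 1)]
    linarith [abs_sub (x t j) (x t i), hb i, hb j]

/-! ### Graphs with at most one incoming edge per node -/

theorem ae_differentiableAt_of_forall_absolutelyContinuousOnInterval {f : ℝ → ℝ}
    (hf : ∀ T, 0 ≤ T → AbsolutelyContinuousOnInterval f 0 T) :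
    ∀ᵐ t : ℝ, 0 ≤ t → DifferentiableAt ℝ f t := by
  have := ae_all_iff.2 fun N : ℕ => (hf N N.cast_nonneg).ae_differentiableAt
  filter_upwards [this] with t ht ht0
  obtain ⟨N, hN⟩ := exists_nat_ge t
  exact ht N (by rw [Set.uIcc_of_le N.cast_nonneg]; exact ⟨ht0, hN⟩)

theorem absolutelyContinuousOnInterval_potential {Δ : ℝ} (hΔ : 0 < Δ) {f : ℝ → ℝ} {a b : ℝ}
    (hf : AbsolutelyContinuousOnInterval f a b) :
    AbsolutelyContinuousOnInterval (fun t => potential Δ (f t)) a b := by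
  obtain ⟨C, hC⟩ := hf.exists_bound
  exact absolutelyContinuousOnInterval_of_dist_le (C := C + Δ / 2) hf fun s hs t ht =>
    abs_potential_sub_le hΔ (hC s hs) (hC t ht)

/-- Convergence when each node `i` listens to a single node `p i`, given weights `c` for which
`∑ i, c i * potential (x (p i) - x i)` decreases at a definite rate off the consensus set. -/
theorem tendsto_infDist_of_parent {n : ℕ} {G : WeightedDigraph n} {Δ : ℝ} (hΔ : 0 < Δ)
    (p : Fin n → Fin n) (α c : Fin n → ℝ) (hα : ∀ i, 0 < α i) (hc : ∀ i, 0 < c i)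
    (hX : ∀ y i, communicationField G (symQuantizer Δ) y i =
      α i * symQuantizer Δ (y (p i) - y i))
    (hp : ∀ i j, G.Edge j i → p i = j) {κ : ℝ} (hκ : 0 < κ)
    (hdec : ∀ y w : Fin n → ℝ, (∀ i, IsSubgradient Δ (y (p i) - y i) (w i)) →
      ∑ i, c i * (w i * (α (p i) * w (p i) - α i * w i)) ≤ 0 ∧
      ∀ i, Δ / 2 < |y (p i) - y i| →
        ∑ i, c i * (w i * (α (p i) * w (p i) - α i * w i)) ≤ -κ)
    {x : ℝ → EuclideanSpace ℝ (Fin n)}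
    (hx : IsFilippovSolution (communicationField G (symQuantizer Δ)) x) :
    Tendsto (fun t => Metric.infDist (x t) (consensusSet G Δ)) atTop (nhds 0) := by
  have hac : ∀ i T, 0 ≤ T →
      AbsolutelyContinuousOnInterval (fun t => potential Δ (x t (p i) - x t i)) 0 T :=
    fun i T hT => absolutelyContinuousOnInterval_potential hΔ
      (((hx.absolutelyContinuous T hT).euclidean_apply (p i)).fun_sub
        ((hx.absolutelyContinuous T hT).euclidean_apply i))
  have hnn : ∀ t i, 0 ≤ c i * potential Δ (x t (p i) - x t i) := fun t i =>
    mul_nonneg (hc i).le (potential_nonneg hΔ _)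
  obtain ⟨m, hm, hmc⟩ := exists_pos_forall_le c hc
  refine tendsto_infDist_of_lyapunov hΔ hx
    (fun t => ∑ i, c i * potential Δ (x t (p i) - x t i)) hκ
    -- Obtained by solving `m * Δ * (|z| - Δ / 2) ≤ V 0` for `|z|`.
    (D := (∑ i, c i * potential Δ (x 0 (p i) - x 0 i)) / m / Δ + Δ / 2)
    (fun t _ => Finset.sum_nonneg fun i _ => hnn t i)
    (fun T hT => absolutelyContinuousOnInterval_sum _ fun i _ => (hac i T hT).const_mul _) ?_ ?_
  · filter_upwards [hx.inclusion, ae_all_iff.2 fun i =>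
      ae_differentiableAt_of_forall_absolutelyContinuousOnInterval (hac i)] with t ht htd ht0
    obtain ⟨v, hv, hv'⟩ := ht ht0
    have hw : ∀ i, IsSubgradient Δ (x t (p i) - x t i) (v i / α i) := fun i =>
      isSubgradient_of_mem_filippovMap hΔ (hα i) (fun y => hX y i) hv
    have hvα : ∀ i, α i * (v i / α i) = v i := fun i => mul_div_cancel₀ _ (hα i).ne'
    have hder : HasDerivAt (fun t => ∑ i, c i * potential Δ (x t (p i) - x t i))
        (∑ i, c i * (v i / α i * (α (p i) * (v (p i) / α (p i)) - α i * (v i / α i)))) t := by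
      refine HasDerivAt.fun_sum fun i _ => HasDerivAt.const_mul _ ?_
      rw [hvα, hvα]
      exact (hw i).hasDerivAt (f := fun s => x s (p i) - x s i)
        ((hasDerivAt_euclidean_apply hv' (p i)).fun_sub (hasDerivAt_euclidean_apply hv' i))
        (htd i ht0)
    rw [hder.deriv]
    obtain ⟨h₁, h₂⟩ := hdec (x t) (fun i => v i / α i) hw
    refine ⟨h₁, fun hmem => ?_⟩
    obtain ⟨j, i, hji, hfar⟩ := exists_edge_of_notMem_consensusSet hmem
    exact h₂ i (by rwa [hp i j hji])
  · intro t _ hVt i j hij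
    have h₁ := (Finset.single_le_sum (fun i _ => hnn t i) (Finset.mem_univ i)).trans hVt
    have h₂ := le_potential_abs hΔ (x t (p i) - x t i)
    have h₃ := mul_le_mul_of_nonneg_right (hmc i) (potential_nonneg hΔ (x t (p i) - x t i))
    rw [← hp i j hij, ← sub_le_iff_le_add, le_div_iff₀ hΔ, le_div_iff₀ hm]
    have h₄ := mul_le_mul_of_nonneg_left h₂ hm.le
    linarith

/-- The edge from `k` need not exist, so this also covers the root of a tree, with `k = i`. -/
theorem communicationField_apply_of_unique {n : ℕ} {G : WeightedDigraph n} {i k : Fin n}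
    (h : ∀ j, G.Edge j i → j = k) (q : ℝ → ℝ) (y : EuclideanSpace ℝ (Fin n)) :
    communicationField G q y i = G.a i k * q (y k - y i) := by
  rw [communicationField_apply]
  refine Finset.sum_eq_single k (fun j _ hj => ?_) (by simp)
  have : G.a i j = 0 := ((G.nonneg i j).eq_or_lt.resolve_right fun h' => hj (h j h')).symm
  simp [this]

/-! ### Directed rings -/

/-- Values that never decrease while following a permutation cannot increase strictly anywhere on
its cycle; here the increase is only guaranteed where a slowly varying speed is positive. -/
theorem perm_no_slow_increase {n : ℕ} (σ : Equiv.Perm (Fin n)) {y u : Fin n → ℝ} {i : Fin n}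
    {η : ℝ} (hmono : ∀ j, 0 < u j → y j ≤ y (σ j)) (hlt : y i < y (σ i))
    (hu : orderOf σ * η ≤ u i) (hη : 0 < η) (hstep : ∀ j, |u (σ j) - u j| < η) : False := by
  have key : ∀ k : ℕ, u i - k * η ≤ u ((σ ^ k) i) := by
    intro k
    induction k with
    | zero => simp
    | succ k ih =>
      have := (abs_lt.1 (hstep ((σ ^ k) i))).1
      rw [pow_succ', Equiv.Perm.mul_apply, Nat.cast_succ]
      linarith
  have key₂ : ∀ k : ℕ, k + 1 ≤ orderOf σ → y (σ i) ≤ y ((σ ^ (k + 1)) i) := by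
    intro k
    induction k with
    | zero => simp
    | succ k ih =>
      intro hk
      refine (ih (by omega)).trans ?_
      rw [pow_succ' σ (k + 1), Equiv.Perm.mul_apply]
      refine hmono _ ?_
      -- Fewer than `orderOf σ` steps have been made, so `u` is still positive here.
      have h₁ : ((k + 1 : ℕ) : ℝ) < orderOf σ := by exact_mod_cast hk
      have h₂ := mul_lt_mul_of_pos_right h₁ hη
      linarith [key (k + 1)]
  obtain ⟨N, hN⟩ : ∃ N, orderOf σ = N + 1 := ⟨orderOf σ - 1, by have := orderOf_pos σ; omega⟩
  have h := key₂ N hN.ge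
  rw [← hN, pow_orderOf_eq_one, Equiv.Perm.one_apply] at h
  exact absurd hlt h.not_gt

theorem tendsto_infDist_of_isDirectedRing {n : ℕ} {G : WeightedDigraph n} (hG : G.IsDirectedRing)
    {Δ : ℝ} (hΔ : 0 < Δ) {x : ℝ → EuclideanSpace ℝ (Fin n)}
    (hx : IsFilippovSolution (communicationField G (symQuantizer Δ)) x) :
    Tendsto (fun t => Metric.infDist (x t) (consensusSet G Δ)) atTop (nhds 0) := by
  choose p hp hpu using fun i => (hG i).2
  have hinj : Function.Injective p := fun i j hij =>
    (hG (p i)).1.unique (hp i) (by rw [hij]; exact hp j)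
  let σ : Equiv.Perm (Fin n) := Equiv.ofBijective p (Finite.injective_iff_bijective.1 hinj)
  set α : Fin n → ℝ := fun i => G.a i (p i) with hαdef
  have hα : ∀ i, 0 < α i := hp
  obtain ⟨m, hm, hmα⟩ := exists_pos_forall_le α hα
  have hN : (0 : ℝ) < orderOf σ := by exact_mod_cast orderOf_pos σ
  -- On a long edge `|α i * w i| ≥ m * Δ`, so increments below `η` cannot exhaust it within one turn
  -- of the ring. Some increment must therefore reach `η`.
  set η : ℝ := m * Δ / orderOf σ with hηdef
  have hη : 0 < η := by positivity
  have hNη : orderOf σ * η = m * Δ := by rw [hηdef]; field_simp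
  refine tendsto_infDist_of_parent hΔ p α α hα hα
    (fun y i => communicationField_apply_of_unique (hpu i) _ y)
    (fun i j hij => (hpu i j hij).symm) (κ := η ^ 2 / 2) (by positivity) (fun y w hw => ?_) hx
  set u : Fin n → ℝ := fun i => α i * w i with hu
  have hsum : ∑ i, α i * (w i * (α (p i) * w (p i) - α i * w i)) =
      -(∑ i, (u (σ i) - u i) ^ 2) / 2 := by
    have h₁ : ∑ i, u (σ i) ^ 2 = ∑ i, u i ^ 2 := Equiv.sum_comp σ fun i => u i ^ 2
    have h₂ : ∑ i, (u (σ i) - u i) ^ 2 =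
        ∑ i, u (σ i) ^ 2 + ∑ i, u i ^ 2 - 2 * ∑ i, u (σ i) * u i := by
      rw [Finset.mul_sum, ← Finset.sum_add_distrib, ← Finset.sum_sub_distrib]
      exact Finset.sum_congr rfl fun i _ => by ring
    have h₃ : ∑ i, α i * (w i * (α (p i) * w (p i) - α i * w i)) =
        ∑ i, u (σ i) * u i - ∑ i, u i ^ 2 := by
      rw [← Finset.sum_sub_distrib]
      refine Finset.sum_congr rfl fun i _ => ?_
      simp only [hu, show σ i = p i from rfl]
      ring
    rw [h₃, h₂, h₁]
    ring
  rw [hsum]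
  have hnn : ∀ i, 0 ≤ (u (σ i) - u i) ^ 2 := fun i => sq_nonneg _
  refine ⟨by linarith [Finset.sum_nonneg fun i (_ : i ∈ Finset.univ) => hnn i], fun i hi => ?_⟩
  by_contra! hcon
  have hstep : ∀ j, |u (σ j) - u j| < η := fun j => by
    have := Finset.single_le_sum (fun i _ => hnn i) (Finset.mem_univ j)
    exact abs_lt_of_sq_lt_sq (by linarith) hη.le
  rcases lt_abs.1 hi with h | h
  · refine perm_no_slow_increase σ (y := y) (u := u) (i := i) (η := η) (fun j hj => ?_)
      (by change y i < y (p i); linarith) ?_ hη hstep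
    · have h₁ : 0 < w j := pos_of_mul_pos_right hj (hα j).le
      have := nonneg_of_mul_nonneg_right ((hw j).mul_nonneg hΔ) h₁
      change y j ≤ y (p j)
      linarith
    · rw [hNη]
      exact mul_le_mul (hmα i) ((hw i).le_of_lt hΔ h) hΔ.le (hα i).le
  -- The negative case is the positive one after reversing the signs of `y` and `u`.
  · refine perm_no_slow_increase σ (y := fun j => -y j) (u := fun j => -u j) (i := i) (η := η)
      (fun j hj => ?_) (by change -y i < -y (p i); linarith) ?_ hη fun j => ?_
    · have h₁ : 0 < -w j := pos_of_mul_pos_right (a := α j) (by linarith) (hα j).le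
      have h₂ : 0 ≤ -w j * -(y (p j) - y j) := by linarith [(hw j).mul_nonneg hΔ]
      have := nonneg_of_mul_nonneg_right h₂ h₁
      change -y j ≤ -y (p j)
      linarith
    · rw [hNη]
      have h₁ := (hw i).le_neg_of_lt hΔ (by linarith)
      have := mul_le_mul (hmα i) (show Δ ≤ -w i by linarith) hΔ.le (hα i).le
      simp only [hu]
      linarith
    · have := hstep j
      rwa [abs_sub_comm, ← neg_sub_neg] at this

/-! ### Directed spanning trees -/

theorem tendsto_infDist_of_isDirectedSpanningTree {n : ℕ} {G : WeightedDigraph n}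
    (hG : G.IsDirectedSpanningTree) {Δ : ℝ} (hΔ : 0 < Δ) {x : ℝ → EuclideanSpace ℝ (Fin n)}
    (hx : IsFilippovSolution (communicationField G (symQuantizer Δ)) x) :
    Tendsto (fun t => Metric.infDist (x t) (consensusSet G Δ)) atTop (nhds 0) := by
  obtain ⟨r, hr, hpar, hreach⟩ := hG
  -- The root is made its own parent: its difference is `0`, which forces `w r = 0`.
  have hex : ∀ i, ∃ k, (i = r → k = r) ∧ (i ≠ r → G.Edge k i) ∧ ∀ j, G.Edge j i → j = k := by
    intro i
    by_cases hi : i = r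
    · subst hi
      exact ⟨i, fun _ => rfl, fun h => absurd rfl h, fun j hj => absurd hj (hr j)⟩
    · obtain ⟨k, hk, hku⟩ := hpar i hi
      exact ⟨k, fun h => absurd h hi, fun _ => hk, hku⟩
  choose p hpr hpe hpu using hex
  have hdepth : ∀ i, ∃ k, p^[k] i = r := by
    intro i
    induction hreach i with
    | refl => exact ⟨0, rfl⟩
    | tail _ hbc ih =>
      obtain ⟨k, hk⟩ := ih
      exact ⟨k + 1, by rw [Function.iterate_succ_apply, ← hpu _ _ hbc, hk]⟩
  classical
  let d : Fin n → ℕ := fun i => Nat.find (hdepth i)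
  have hd : ∀ i, i ≠ r → d (p i) + 1 ≤ d i := by
    intro i hi
    have h₁ : p^[d i] i = r := Nat.find_spec (hdepth i)
    obtain ⟨k, hk⟩ : ∃ k, d i = k + 1 :=
      Nat.exists_eq_succ_of_ne_zero fun h => hi (by rwa [h] at h₁)
    rw [hk, Function.iterate_succ_apply] at h₁
    rw [hk]
    exact Nat.succ_le_succ (Nat.find_min' (hdepth (p i)) h₁)
  set α : Fin n → ℝ := fun i => if i = r then 1 else G.a i (p i) with hαdef
  have hα : ∀ i, 0 < α i := fun i => by
    simp only [hαdef]
    split_ifs with h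
    exacts [one_pos, hpe i h]
  have hX : ∀ y i, communicationField G (symQuantizer Δ) y i =
      α i * symQuantizer Δ (y (p i) - y i) := by
    intro y i
    rw [communicationField_apply_of_unique (hpu i)]
    by_cases h : i = r
    · have : p i = i := (hpr i h).trans h.symm
      rw [this, sub_self, symQuantizer_zero, mul_zero, mul_zero]
    · simp [hαdef, h]
  obtain ⟨m, hm, hmα⟩ := exists_pos_forall_le α hα
  set M : ℝ := ∑ i, α i with hM
  have hαM : ∀ i, α i ≤ M := fun i =>
    Finset.single_le_sum (fun i _ => (hα i).le) (Finset.mem_univ i)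
  -- Young's constant: `M * |a * b| ≤ m / 2 * a² + K * b²`.
  set K : ℝ := M ^ 2 / (2 * m) with hK
  have hK0 : 0 ≤ K := by positivity
  -- Bounding each of the `n` parent terms by the whole sum `S` costs `ε * K * n`, which must leave
  -- half of the `m / 2` dissipation.
  obtain ⟨ε, hε, hε1, hεK⟩ : ∃ ε : ℝ, 0 < ε ∧ ε ≤ 1 ∧ ε * K * n ≤ m / 4 := by
    refine ⟨min 1 (m / (4 * (K * n + 1))), by positivity, min_le_left _ _, ?_⟩
    have h₁ := min_le_right 1 (m / (4 * (K * n + 1)))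
    rw [le_div_iff₀ (by positivity)] at h₁
    have h₂ : 0 < min 1 (m / (4 * (K * n + 1))) := by positivity
    nlinarith
  set c : Fin n → ℝ := fun i => ε ^ d i with hcdef
  have hc : ∀ i, 0 < c i := fun i => pow_pos hε _
  have hcp : ∀ i, i ≠ r → c i ≤ ε * c (p i) := fun i hi => by
    simp only [hcdef]
    rw [← pow_succ']
    exact pow_le_pow_of_le_one hε.le hε1 (hd i hi)
  obtain ⟨c₀, hc₀, hc₀c⟩ := exists_pos_forall_le c hc
  refine tendsto_infDist_of_parent hΔ p α c hα hc hX (fun i j hij => (hpu i j hij).symm)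
    (κ := m / 4 * (c₀ * Δ ^ 2)) (by positivity) (fun y w hw => ?_) hx
  have hwr : w r = 0 := by
    have := hw r
    rw [hpr r rfl, sub_self] at this
    exact this.eq_zero hΔ
  have hnn : ∀ i, 0 ≤ c i * w i ^ 2 := fun i => mul_nonneg (hc i).le (sq_nonneg _)
  set S : ℝ := ∑ i, c i * w i ^ 2 with hS
  have hterm : ∀ i, c i * (w i * (α (p i) * w (p i) - α i * w i)) ≤
      -(m / 2) * (c i * w i ^ 2) + ε * K * (c (p i) * w (p i) ^ 2) := by
    intro i
    by_cases hi : i = r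
    · rw [hpr i hi, hi, hwr]
      simp
    · have h₁ : w i * (α (p i) * w (p i)) ≤ m / 2 * w i ^ 2 + K * w (p i) ^ 2 := by
        have e : m / 2 * w i ^ 2 + K * w (p i) ^ 2 - w i * (α (p i) * w (p i)) =
            ((m * w i - α (p i) * w (p i)) ^ 2 + (M ^ 2 - α (p i) ^ 2) * w (p i) ^ 2) /
              (2 * m) := by
          rw [hK]; field_simp; ring
        have h₂ : α (p i) ^ 2 ≤ M ^ 2 := pow_le_pow_left₀ (hα _).le (hαM _) 2
        have h₃ : 0 ≤ (M ^ 2 - α (p i) ^ 2) * w (p i) ^ 2 :=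
          mul_nonneg (by linarith) (sq_nonneg _)
        have : 0 ≤ m / 2 * w i ^ 2 + K * w (p i) ^ 2 - w i * (α (p i) * w (p i)) := by
          rw [e]; positivity
        linarith
      have h₄ : m * w i ^ 2 ≤ α i * w i ^ 2 :=
        mul_le_mul_of_nonneg_right (hmα i) (sq_nonneg _)
      have h₅ : w i * (α (p i) * w (p i) - α i * w i) ≤
          -(m / 2) * w i ^ 2 + K * w (p i) ^ 2 := by linarith
      have h₆ := mul_le_mul_of_nonneg_left h₅ (hc i).le
      have h₇ := mul_le_mul_of_nonneg_right (hcp i hi)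
        (show 0 ≤ K * w (p i) ^ 2 by positivity)
      linarith
  have hle : ∑ i, c i * (w i * (α (p i) * w (p i) - α i * w i)) ≤ -(m / 4 * S) := by
    have h₁ := Finset.sum_le_sum fun i (_ : i ∈ Finset.univ) => hterm i
    rw [Finset.sum_add_distrib, ← Finset.mul_sum, ← Finset.mul_sum] at h₁
    have h₂ : ∑ i, c (p i) * w (p i) ^ 2 ≤ ∑ _i : Fin n, S :=
      Finset.sum_le_sum fun i _ =>
        Finset.single_le_sum (fun i _ => hnn i) (Finset.mem_univ (p i))
    rw [Finset.sum_const, Finset.card_univ, Fintype.card_fin, nsmul_eq_mul] at h₂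
    have hS0 : 0 ≤ S := Finset.sum_nonneg fun i _ => hnn i
    have h₃ := mul_le_mul_of_nonneg_left h₂ (show 0 ≤ ε * K by positivity)
    have h₄ := mul_le_mul_of_nonneg_right hεK hS0
    linarith
  refine ⟨hle.trans ?_, fun i hi => hle.trans ?_⟩
  · have hS0 : 0 ≤ S := Finset.sum_nonneg fun i _ => hnn i
    have : 0 ≤ m / 4 * S := by positivity
    linarith
  · have h₁ : c i * w i ^ 2 ≤ S :=
      Finset.single_le_sum (fun i _ => hnn i) (Finset.mem_univ i)
    have h₂ : Δ ^ 2 ≤ w i ^ 2 := by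
      rw [← sq_abs (w i)]
      exact pow_le_pow_left₀ hΔ.le ((hw i).le_abs hΔ hi) 2
    have h₃ := mul_le_mul (hc₀c i) h₂ (sq_nonneg Δ) (hc i).le
    have := mul_le_mul_of_nonneg_left (h₃.trans h₁) (show 0 ≤ m / 4 by positivity)
    linarith

end QuantizedConsensus

theorem mainTheorem7 {n : ℕ} (G : QuantizedConsensus.WeightedDigraph n) (Δ : ℝ) (hΔ : 0 < Δ)
    (hG : G.IsUndirected ∨ G.IsDirectedRing ∨ G.IsDirectedSpanningTree)
    (x : ℝ → EuclideanSpace ℝ (Fin n))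
    (hx : QuantizedConsensus.IsFilippovSolution
      (QuantizedConsensus.communicationField G (QuantizedConsensus.symQuantizer Δ)) x) :
    Filter.Tendsto (fun t : ℝ => Metric.infDist (x t) (QuantizedConsensus.consensusSet G Δ))
      Filter.atTop (nhds 0) := by
  rcases hG with hG | hG | hG
  · exact QuantizedConsensus.tendsto_infDist_of_isUndirected hG hΔ hx
  · exact QuantizedConsensus.tendsto_infDist_of_isDirectedRing hG hΔ hx
  · exact QuantizedConsensus.tendsto_infDist_of_isDirectedSpanningTree hG hΔ hx
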